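/- For ordinals $\alpha,\beta$ write $\alpha\to\beta$ if there are a formula $\varphi(x,y,\bar X)$ of the monadic second-order language of order $\{<\}$ (quantification over elements and over arbitrary subsets) and a finite tuple $\bar P$ of subsets of $\alpha$ such that the relation $x<^*y\iff(\alpha,<)\models\varphi(x,y,\bar P)$ is a well-ordering of the elements of $\alpha$ of order type $\beta$. Suppose that $\alpha\to\beta$ and $\beta<\alpha$. Then there are ordinals $\gamma_1,\gamma_2$ with $\gamma_1+\gamma_2=\alpha$ and $\gamma_2+\gamma_1=\beta$. In particular, $\omega+\omega\not\to\omega$. -/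

import Mathlib

universe u

/-- Formulas of the monadic second-order language of order whose free variables are among
`X_0, …, X_{n-1}`. All variables are set variables; an individual variable `x` is represented by a
set variable `X` with `sing(X)`, so that quantification over elements is quantification over sets
relativized to `sing`. In `ex φ` the bound variable of `φ` is its variable `X_0`, and the free
variable `X_i` of `ex φ` is the variable `X_{i+1}` of `φ`. -/
inductive MSOFormula : ℕ → Type
  /-- `X_i` is a singleton. -/
  | sing {n : ℕ} (i : Fin n) : MSOFormula n
  /-- `X_i = {x}` is a singleton and `x ∈ X_j`. -/
  | mem {n : ℕ} (i j : Fin n) : MSOFormula n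
  /-- `X_i = {x}` and `X_j = {y}` are singletons and `x < y`. -/
  | lt {n : ℕ} (i j : Fin n) : MSOFormula n
  /-- Negation. -/
  | not {n : ℕ} (φ : MSOFormula n) : MSOFormula n
  /-- Conjunction. -/
  | and {n : ℕ} (φ ψ : MSOFormula n) : MSOFormula n
  /-- Existential quantification over a set. -/
  | ex {n : ℕ} (φ : MSOFormula (n + 1)) : MSOFormula n

/-- Satisfaction of a monadic second-order formula in the structure `(A, <)`, the set variables
ranging over all subsets of `A`. -/
def MSOFormula.Realize {A : Type u} [LT A] : {n : ℕ} → MSOFormula n → (Fin n → Set A) → Prop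
  | _, .sing i, v => ∃ x : A, v i = {x}
  | _, .mem i j, v => ∃ x : A, v i = {x} ∧ x ∈ v j
  | _, .lt i j, v => ∃ x y : A, v i = {x} ∧ v j = {y} ∧ x < y
  | _, .not φ, v => ¬ φ.Realize v
  | _, .and φ ψ, v => φ.Realize v ∧ ψ.Realize v
  | _, .ex φ, v => ∃ S : Set A, φ.Realize (Matrix.vecCons S v)

/-- The binary relation `x <* y` on `A` that the formula `φ(x, y, P̄)` defines in `(A, <)`, with a
finite tuple `P̄` of subsets of `A` as parameters. -/
def MSOFormula.definedRel {A : Type u} [LT A] {l : ℕ} (φ : MSOFormula (l + 2))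
    (P : Fin l → Set A) (x y : A) : Prop :=
  φ.Realize (Matrix.vecCons {x} (Matrix.vecCons {y} P))

/-- `α → β`: some monadic second-order formula with parameters defines, in the structure `(α, <)`,
a (strict) well-ordering of the elements of `α` of order type `β`. -/
def MSOArrow (α β : Ordinal.{u}) : Prop :=
  ∃ (l : ℕ) (φ : MSOFormula (l + 2)) (P : Fin l → Set α.ToType)
    (_ : IsWellOrder α.ToType (φ.definedRel P)), Ordinal.type (φ.definedRel P) = β

/-! The core is a transfer principle (`MSOArrow.omega0_opow_mul_le`): if `α → β` and `ω ^ a * n ≤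
α`, then `ω ^ a * n ≤ β`. Writing `α = ω ^ a * n + ρ` with `ρ < ω ^ a ≤ α`, it gives `β ≥ ω ^ a *
n`, so the remainder `α - β ≤ ρ` is absorbed when added to the left of `β`: the rotation is `γ₁ =
β`, `γ₂ = α - β`. Transfer goes by induction on `a`, then on `n`. Split the set as `t` below `u`,
with `u` of type at least `ω ^ a`. By composition (`msoType_union`), how `x ∈ t` compares under `<*`
with `y ∈ u` depends only on `x` and on one of finitely many types of `y` in `u`. Since `ω ^ a` is
additively indivisible, some type class in `u` still has `<*`-type at least `ω ^ a`. Each element of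
`t` lies wholly on one side of that class, so the class is inserted into a single cut of `t` and
adds a further `ω ^ a`. -/

/-! ### Order types of subsets and powers of `ω`. -/

section OrderTypes

open Ordinal

/-- The order type of the subset `X` under the well-ordering `R`. -/
noncomputable def subsetType {A : Type u} (R : A → A → Prop) [IsWellOrder A R] (X : Set A) :
    Ordinal.{u} :=
  Ordinal.type (Subrel R (· ∈ X))

variable {A : Type u} (R : A → A → Prop) [IsWellOrder A R]

theorem subsetType_mono {X Y : Set A} (h : X ⊆ Y) : subsetType R X ≤ subsetType R Y :=
  RelEmbedding.ordinal_type_le (Subrel.inclusionEmbedding R h)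

theorem subsetType_univ : subsetType R Set.univ = Ordinal.type R :=
  RelIso.ordinalType_congr
    { toEquiv := Equiv.Set.univ A
      map_rel_iff' := Iff.rfl }

theorem subsetType_eq_zero_iff {X : Set A} : subsetType R X = 0 ↔ X = ∅ := by
  rw [subsetType, type_eq_zero_iff_isEmpty, Set.isEmpty_coe_sort]

theorem subsetType_union {X Y : Set A} (h : ∀ x ∈ X, ∀ y ∈ Y, R x y) :
    subsetType R (X ∪ Y) = subsetType R X + subsetType R Y := by
  classical
  have hd : Disjoint X Y := by
    rw [Set.disjoint_left]
    intro x hx hy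
    exact irrefl_of R x (h x hx x hy)
  unfold subsetType
  rw [← type_sum_lex]
  refine RelIso.ordinalType_congr { toEquiv := Equiv.Set.union hd, map_rel_iff' := ?_ }
  have key : ∀ p q : X ⊕ Y, Sum.Lex (Subrel R (· ∈ X)) (Subrel R (· ∈ Y)) p q ↔
      R (((Equiv.Set.union hd).symm p : ↥(X ∪ Y)) : A) ((Equiv.Set.union hd).symm q : ↥(X ∪ Y)) := by
    rintro (⟨x, hx⟩ | ⟨x, hx⟩) (⟨y, hy⟩ | ⟨y, hy⟩)
    · simp
    · simpa using h x hx y hy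
    · simpa using asymm_of R (h y hy x hx)
    · simp
  intro a b
  rw [key]
  simp

/-- A subset of order type at least `o` splits into an initial part of order type `o`
and a final part. -/
theorem exists_split_of_le_subsetType {X : Set A} {o : Ordinal.{u}} (h : o ≤ subsetType R X) :
    ∃ Y Z : Set A, X = Y ∪ Z ∧ (∀ y ∈ Y, ∀ z ∈ Z, R y z) ∧ subsetType R Y = o := by
  rcases h.eq_or_lt with h | h
  · exact ⟨X, ∅, by simp, by simp, h.symm⟩
  · obtain ⟨a, ha⟩ := typein_surj (Subrel R (· ∈ X)) h
    refine ⟨{x ∈ X | R x a}, {x ∈ X | ¬ R x a}, ?_, ?_, ?_⟩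
    · ext x
      by_cases hx : R x a <;> simp [hx]
    · rintro y ⟨-, hy⟩ z ⟨-, hz⟩
      rcases trichotomous_of R z a with h' | h' | h'
      · exact absurd h' hz
      · exact h' ▸ hy
      · exact trans_of R hy h'
    · rw [← ha, ← type_subrel]
      exact RelIso.ordinalType_congr
        { toFun := fun x => ⟨⟨x.1, x.2.1⟩, x.2.2⟩
          invFun := fun x => ⟨x.1.1, x.1.2, x.2⟩
          left_inv := fun _ => rfl
          right_inv := fun _ => rfl
          map_rel_iff' := Iff.rfl }

theorem exists_split_of_add_le_subsetType {X : Set A} {o o' : Ordinal.{u}}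
    (h : o + o' ≤ subsetType R X) :
    ∃ Y Z : Set A, X = Y ∪ Z ∧ (∀ y ∈ Y, ∀ z ∈ Z, R y z) ∧
      o ≤ subsetType R Y ∧ o' ≤ subsetType R Z := by
  obtain ⟨Y, Z, rfl, hR, rfl⟩ := exists_split_of_le_subsetType R (le_self_add.trans h)
  refine ⟨Y, Z, rfl, hR, le_rfl, ?_⟩
  rw [subsetType_union R hR] at h
  exact le_of_add_le_add_left h

theorem opow_succ_le_iff_forall_nat {a b : Ordinal.{u}} :
    ω ^ (a + 1) ≤ b ↔ ∀ n : ℕ, ω ^ a * n ≤ b := by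
  rw [← Order.succ_eq_add_one, opow_succ, mul_le_iff_of_isSuccLimit isSuccLimit_omega0]
  constructor
  · exact fun h n => h n (natCast_lt_omega0 n)
  · intro h c hc
    obtain ⟨n, rfl⟩ := lt_omega0.1 hc
    exact h n

/-- Powers of `ω` are additively indivisible. -/
theorem omega0_opow_le_subsetType_or (a : Ordinal.{u}) :
    ∀ X Y : Set A, ω ^ a ≤ subsetType R (X ∪ Y) →
      ω ^ a ≤ subsetType R X ∨ ω ^ a ≤ subsetType R Y := by
  induction a using Ordinal.limitRecOn with
  | zero =>
    intro X Y h
    simp only [opow_zero, Order.one_le_iff_ne_zero, ne_eq, subsetType_eq_zero_iff,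
      Set.union_empty_iff, not_and_or] at h ⊢
    exact h
  | add_one a ih =>
    intro X Y h
    -- Pigeonhole with multiplicities: by `ih` the final piece `T` gives a copy of `ω ^ a` to `X` or
    -- to `Y`, lowering `m` or `n` by one.
    have key : ∀ k m n : ℕ, k = m + n → ∀ X Y : Set A, ω ^ a * (k : Ordinal) ≤ subsetType R (X ∪ Y) →
        ω ^ a * (m : Ordinal) ≤ subsetType R X ∨ ω ^ a * (n : Ordinal) ≤ subsetType R Y := by
      intro k
      induction k with
      | zero =>
        intro m n hk X Y _
        obtain rfl : m = 0 := by omega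
        simp
      | succ k ihk =>
        intro m n hk X Y h
        rw [Nat.cast_succ, mul_add, mul_one] at h
        obtain ⟨S, T, hST, hR, hS, hT⟩ := exists_split_of_add_le_subsetType R h
        rw [show T = (X ∩ T) ∪ (Y ∩ T) by
          rw [← Set.union_inter_distrib_right, hST, Set.union_inter_cancel_right]] at hT
        rw [show S = (X ∩ S) ∪ (Y ∩ S) by
          rw [← Set.union_inter_distrib_right, hST, Set.union_inter_cancel_left]] at hS
        have join : ∀ (Z : Set A) (j : ℕ), ω ^ a * (j : Ordinal) ≤ subsetType R (Z ∩ S) →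
            ω ^ a ≤ subsetType R (Z ∩ T) →
            ω ^ a * ((j + 1 : ℕ) : Ordinal) ≤ subsetType R Z := by
          intro Z j h₁ h₂
          rw [Nat.cast_succ, mul_add, mul_one]
          refine (add_le_add h₁ h₂).trans ?_
          rw [← subsetType_union R fun x hx y hy => hR x hx.2 y hy.2]
          exact subsetType_mono R (by simp)
        rcases ih _ _ hT with hT | hT
        · rcases m with _ | m
          · simp
          rcases ihk m n (by omega) _ _ hS with hS | hS
          · exact Or.inl (join X m hS hT)
          · exact Or.inr (hS.trans (subsetType_mono R Set.inter_subset_left))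
        · rcases n with _ | n
          · simp
          rcases ihk m n (by omega) _ _ hS with hS | hS
          · exact Or.inl (hS.trans (subsetType_mono R Set.inter_subset_left))
          · exact Or.inr (join Y n hS hT)
    simp only [opow_succ_le_iff_forall_nat] at h ⊢
    by_contra! hcon
    obtain ⟨⟨m, hm⟩, n, hn⟩ := hcon
    rcases key _ m n rfl X Y (h _) with h' | h'
    · exact absurd h' hm.not_ge
    · exact absurd h' hn.not_ge
  | limit a ha ih =>
    intro X Y h
    simp only [opow_le_of_isSuccLimit omega0_ne_zero ha] at h ⊢
    by_contra! hcon
    obtain ⟨⟨b, hb, hX⟩, c, hc, hY⟩ := hcon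
    rcases ih (max b c) (max_lt hb hc) X Y (h _ (max_lt hb hc)) with h' | h'
    · exact absurd ((opow_le_opow_right omega0_pos (le_max_left b c)).trans h') hX.not_ge
    · exact absurd ((opow_le_opow_right omega0_pos (le_max_right b c)).trans h') hY.not_ge

/-- If a set of order type at least `ω ^ a` is coloured with finitely many colours, then some
colour class has order type at least `ω ^ a`. -/
theorem exists_colour_omega0_opow_le {Q : Type*} [Finite Q] (c : A → Q) {a : Ordinal.{u}}
    {X : Set A} (h : ω ^ a ≤ subsetType R X) : ∃ q, ω ^ a ≤ subsetType R {x ∈ X | c x = q} := by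
  classical
  have := Fintype.ofFinite Q
  have key : ∀ F : Finset Q, ω ^ a ≤ subsetType R {x ∈ X | c x ∈ F} →
      ∃ q, ω ^ a ≤ subsetType R {x ∈ X | c x = q} := by
    intro F
    induction F using Finset.induction_on with
    | empty =>
      intro h
      rw [show {x ∈ X | c x ∈ (∅ : Finset Q)} = ∅ by simp, (subsetType_eq_zero_iff R).2 rfl] at h
      exact absurd h (opow_pos a omega0_pos).not_ge
    | insert q F _ ih =>
      intro h
      rw [show {x ∈ X | c x ∈ insert q F} = {x ∈ X | c x = q} ∪ {x ∈ X | c x ∈ F} by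
        ext x; simp only [Finset.mem_insert, Set.mem_ofPred_eq, Set.mem_union]; tauto] at h
      rcases omega0_opow_le_subsetType_or R a _ _ h with h | h
      · exact ⟨q, h⟩
      · exact ih h
  exact key Finset.univ (by simpa using h)

/-- Inserting `ω ^ a` into a cut of an ordinal that is at least `ω ^ a * n`. -/
theorem omega0_opow_mul_succ_le_insert {a : Ordinal.{u}} (n : ℕ) :
    ∀ x y : Ordinal.{u}, ω ^ a * n ≤ x + y → ω ^ a * (n + 1 : ℕ) ≤ x + ω ^ a + y := by
  induction n with
  | zero =>
    intro x y _
    simpa using le_add_self.trans le_self_add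
  | succ n ih =>
    intro x y h
    have e : ∀ k : ℕ, ω ^ a * ((k + 1 : ℕ) : Ordinal.{u}) = ω ^ a + ω ^ a * k := by
      intro k
      rw [Nat.add_comm, Nat.cast_add, Nat.cast_one, mul_add, mul_one]
    rw [e] at h
    rw [e]
    -- If `x < ω ^ a`, the inserted block absorbs `x`, and `y` alone must carry the old bound.
    -- Otherwise a copy of `ω ^ a` is peeled off the front of `x`.
    rcases lt_or_ge x (ω ^ a) with hx | hx
    · rw [add_omega0_opow hx, e]
      gcongr
      by_contra! hy
      have := (add_lt_add_iff_left x).2 hy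
      rw [← add_assoc, add_omega0_opow hx] at this
      exact absurd h this.not_ge
    · rw [← Ordinal.add_sub_cancel_of_le hx, add_assoc] at h ⊢
      rw [add_assoc]
      gcongr
      rw [← add_assoc]
      exact ih _ _ (le_of_add_le_add_left h)

/-- A well-ordered set gains order type when a block, comparable as a whole with each of its
elements, is inserted. -/
theorem omega0_opow_mul_succ_le_subsetType_union {X B : Set A} (hd : Disjoint X B)
    (hB : ∀ x ∈ X, ∀ y ∈ B, ∀ y' ∈ B, R x y ↔ R x y') {a : Ordinal.{u}} {n : ℕ}
    (hX : ω ^ a * n ≤ subsetType R X) (ha : ω ^ a ≤ subsetType R B) :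
    ω ^ a * (n + 1 : ℕ) ≤ subsetType R (X ∪ B) := by
  obtain ⟨b, hb⟩ : B.Nonempty := by
    rw [Set.nonempty_iff_ne_empty, ne_eq, ← subsetType_eq_zero_iff R, ← ne_eq,
      ← pos_iff_ne_zero]
    exact (opow_pos a omega0_pos).trans_le ha
  -- By `hB` this cut of `X` is the same for every choice of `b ∈ B`.
  have hsplit : X = {x ∈ X | R x b} ∪ {x ∈ X | ¬ R x b} := by
    ext x
    by_cases hx : R x b <;> simp [hx]
  have hR : ∀ x ∈ X, ∀ y ∈ B, ¬ R x b → R y x := by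
    intro x hx y hy hxb
    rw [hB x hx b hb y hy] at hxb
    rcases trichotomous_of R y x with h | rfl | h
    · exact h
    · exact absurd hy (Set.disjoint_left.1 hd hx)
    · exact absurd h hxb
  have h₁ : ∀ x ∈ {x ∈ X | R x b}, ∀ y ∈ B, R x y := fun x hx y hy => (hB x hx.1 b hb y hy).1 hx.2
  have h₂ : ∀ x ∈ {x ∈ X | R x b} ∪ B, ∀ y ∈ {x ∈ X | ¬ R x b}, R x y := by
    rintro x (hx | hx) y hy
    · exact trans_of R hx.2 (hR y hy.1 b hb hy.2)
    · exact hR y hy.1 x hx hy.2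
  rw [hsplit, subsetType_union R
    fun x hx y hy => trans_of R hx.2 (hR y hy.1 b hb hy.2)] at hX
  rw [hsplit, Set.union_right_comm, subsetType_union R h₂, subsetType_union R h₁]
  refine (omega0_opow_mul_succ_le_insert n _ _ hX).trans ?_
  gcongr

end OrderTypes

/-! ### Finite-depth types and the composition theorem. -/

section Types

/-- Atomic types: which of the sets `X_i` are empty or singletons, and which of the atomic formulas
`mem i j` and `lt i j` hold. -/
abbrev AtomicType (n : ℕ) : Type :=
  (Fin n → Prop) × (Fin n → Prop) × (Fin n → Fin n → Prop) × (Fin n → Fin n → Prop)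

/-- Possible monadic second-order types of quantifier depth `d` in `n` free set variables. -/
def MSOType : ℕ → ℕ → Type
  | 0, n => AtomicType n
  | d + 1, n => MSOType d n × Set (MSOType d (n + 1))

instance MSOType.finite : ∀ d n : ℕ, Finite (MSOType d n)
  | 0, n => inferInstanceAs (Finite (AtomicType n))
  | d + 1, n =>
    have := MSOType.finite d n
    have := MSOType.finite d (n + 1)
    inferInstanceAs (Finite (MSOType d n × Set (MSOType d (n + 1))))

theorem inter_union_eq_singleton_iff {A : Type u} {s t B : Set A} (hst : Disjoint s t) {x : A} :
    B ∩ (s ∪ t) = {x} ↔ (B ∩ s = {x} ∧ B ∩ t = ∅) ∨ (B ∩ s = ∅ ∧ B ∩ t = {x}) := by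
  rw [Set.inter_union_distrib_left]
  constructor
  · intro h
    have hs : B ∩ s ⊆ {x} := h ▸ Set.subset_union_left
    have ht : B ∩ t ⊆ {x} := h ▸ Set.subset_union_right
    rcases Set.subset_singleton_iff_eq.1 hs with hs | hs <;>
      rcases Set.subset_singleton_iff_eq.1 ht with ht | ht
    · simp [hs, ht] at h
    · exact Or.inr ⟨hs, ht⟩
    · exact Or.inl ⟨hs, ht⟩
    · exact absurd (hs ▸ rfl : x ∈ B ∩ s).2
        fun hx => Set.disjoint_left.1 hst hx (ht ▸ rfl : x ∈ B ∩ t).2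
  · rintro (⟨h₁, h₂⟩ | ⟨h₁, h₂⟩) <;> simp [h₁, h₂]

variable {A : Type u} [LinearOrder A]

/-- The type of depth `d` realized by the traces of `v` on the substructure `s`. -/
def msoType (s : Set A) : (d : ℕ) → {n : ℕ} → (Fin n → Set A) → MSOType d n
  | 0, _, v =>
    -- Emptiness is recorded because a singleton trace on an ordered sum is a singleton on one
    -- summand and empty on the other.
    (fun i => v i ∩ s = ∅, fun i => ∃ x, v i ∩ s = {x},
      fun i j => ∃ x, v i ∩ s = {x} ∧ x ∈ v j,
      fun i j => ∃ x y, v i ∩ s = {x} ∧ v j ∩ s = {y} ∧ x < y)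
  | d + 1, _, v => (msoType s d v, {τ | ∃ S : Set A, msoType s d (Matrix.vecCons S v) = τ})

theorem msoType_zero_eq_iff {s : Set A} {n : ℕ} {v w : Fin n → Set A} :
    msoType s 0 v = msoType s 0 w ↔
      (∀ i, v i ∩ s = ∅ ↔ w i ∩ s = ∅) ∧ (∀ i, (∃ x, v i ∩ s = {x}) ↔ ∃ x, w i ∩ s = {x}) ∧
      (∀ i j, (∃ x, v i ∩ s = {x} ∧ x ∈ v j) ↔ ∃ x, w i ∩ s = {x} ∧ x ∈ w j) ∧
      ∀ i j, (∃ x y, v i ∩ s = {x} ∧ v j ∩ s = {y} ∧ x < y) ↔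
        ∃ x y, w i ∩ s = {x} ∧ w j ∩ s = {y} ∧ x < y := by
  simp only [msoType, MSOType, AtomicType, Prod.mk.injEq, funext_iff, eq_iff_iff]

theorem msoType_succ_eq_iff {s : Set A} {d n : ℕ} {v w : Fin n → Set A} :
    msoType s (d + 1) v = msoType s (d + 1) w ↔ msoType s d v = msoType s d w ∧
      (∀ S, ∃ T, msoType s d (Matrix.vecCons S v) = msoType s d (Matrix.vecCons T w)) ∧
      ∀ T, ∃ S, msoType s d (Matrix.vecCons S v) = msoType s d (Matrix.vecCons T w) := by
  simp only [msoType, MSOType, Prod.mk.injEq, Set.ext_iff, Set.mem_ofPred_eq]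
  refine and_congr_right fun _ => ⟨fun h => ⟨fun S => ?_, fun T => ?_⟩, fun h τ => ⟨?_, ?_⟩⟩
  · obtain ⟨T, hT⟩ := (h _).1 ⟨S, rfl⟩
    exact ⟨T, hT.symm⟩
  · exact (h _).2 ⟨T, rfl⟩
  · rintro ⟨S, rfl⟩
    obtain ⟨T, hT⟩ := h.1 S
    exact ⟨T, hT.symm⟩
  · rintro ⟨T, rfl⟩
    exact h.2 T

theorem msoType_eq_of_le {s : Set A} {d e n : ℕ} (h : d ≤ e) {v w : Fin n → Set A}
    (hvw : msoType s e v = msoType s e w) : msoType s d v = msoType s d w := by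
  induction e, h using Nat.le_induction with
  | base => exact hvw
  | succ e _ ih => exact ih (msoType_succ_eq_iff.1 hvw).1

/-- The type on `s` depends only on the traces on `s`. -/
theorem msoType_congr {s : Set A} (d : ℕ) : ∀ {n : ℕ} {v w : Fin n → Set A},
    (∀ i, v i ∩ s = w i ∩ s) → msoType s d v = msoType s d w := by
  induction d with
  | zero =>
    intro n v w h
    have hmem : ∀ i j x, v i ∩ s = {x} → (x ∈ v j ↔ x ∈ w j) := by
      intro i j x hx
      have hxs : x ∈ s := (hx ▸ rfl : x ∈ v i ∩ s).2
      have := Set.ext_iff.1 (h j) x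
      simpa [hxs] using this
    rw [msoType_zero_eq_iff]
    refine ⟨fun i => by rw [h], fun i => by rw [h], fun i j => ?_, fun i j => by rw [h, h]⟩
    refine exists_congr fun x => ?_
    rw [← h i]
    exact and_congr_right fun hx => hmem i j x hx
  | succ d ih =>
    intro n v w h
    have hc : ∀ S : Set A, msoType s d (Matrix.vecCons S v) = msoType s d (Matrix.vecCons S w) :=
      fun S => ih (Fin.cases rfl h)
    exact msoType_succ_eq_iff.2 ⟨ih h, fun S => ⟨S, hc S⟩, fun S => ⟨S, hc S⟩⟩

/-- Each atomic fact on the sum is a Boolean combination of atomic facts on the summands; an order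
relation across them is fixed by `hst`. -/
theorem msoType_zero_union {s t : Set A} (hst : ∀ x ∈ s, ∀ y ∈ t, x < y) {n : ℕ}
    {v w : Fin n → Set A} (hs : msoType s 0 v = msoType s 0 w)
    (ht : msoType t 0 v = msoType t 0 w) : msoType (s ∪ t) 0 v = msoType (s ∪ t) 0 w := by
  have hd : Disjoint s t := Set.disjoint_left.2 fun x hx hy => lt_irrefl x (hst x hx x hy)
  have mem_of : ∀ {B r : Set A} {x : A}, B ∩ r = {x} → x ∈ r :=
    fun {B r x} h => (h ▸ rfl : x ∈ B ∩ r).2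
  have hsing : ∀ v : Fin n → Set A, ∀ i, (∃ x, v i ∩ (s ∪ t) = {x}) ↔
      ((∃ x, v i ∩ s = {x}) ∧ v i ∩ t = ∅) ∨ (v i ∩ s = ∅ ∧ ∃ x, v i ∩ t = {x}) := by
    intro v i
    simp only [inter_union_eq_singleton_iff hd, exists_or, exists_and_left, exists_and_right]
  have hmem : ∀ v : Fin n → Set A, ∀ i j, (∃ x, v i ∩ (s ∪ t) = {x} ∧ x ∈ v j) ↔
      ((∃ x, v i ∩ s = {x} ∧ x ∈ v j) ∧ v i ∩ t = ∅) ∨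
      (v i ∩ s = ∅ ∧ ∃ x, v i ∩ t = {x} ∧ x ∈ v j) := by
    intro v i j
    simp only [inter_union_eq_singleton_iff hd]
    constructor
    · rintro ⟨x, ⟨h₁, h₂⟩ | ⟨h₁, h₂⟩, h₃⟩
      · exact Or.inl ⟨⟨x, h₁, h₃⟩, h₂⟩
      · exact Or.inr ⟨h₁, x, h₂, h₃⟩
    · rintro (⟨⟨x, h₁, h₃⟩, h₂⟩ | ⟨h₁, x, h₂, h₃⟩)
      · exact ⟨x, Or.inl ⟨h₁, h₂⟩, h₃⟩
      · exact ⟨x, Or.inr ⟨h₁, h₂⟩, h₃⟩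
  have hlt : ∀ v : Fin n → Set A, ∀ i j,
      (∃ x y, v i ∩ (s ∪ t) = {x} ∧ v j ∩ (s ∪ t) = {y} ∧ x < y) ↔
      ((∃ x y, v i ∩ s = {x} ∧ v j ∩ s = {y} ∧ x < y) ∧ v i ∩ t = ∅ ∧ v j ∩ t = ∅) ∨
      ((∃ x y, v i ∩ t = {x} ∧ v j ∩ t = {y} ∧ x < y) ∧ v i ∩ s = ∅ ∧ v j ∩ s = ∅) ∨
      ((∃ x, v i ∩ s = {x}) ∧ v i ∩ t = ∅ ∧ v j ∩ s = ∅ ∧ ∃ y, v j ∩ t = {y}) := by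
    intro v i j
    simp only [inter_union_eq_singleton_iff hd]
    constructor
    · rintro ⟨x, y, ⟨h₁, h₂⟩ | ⟨h₁, h₂⟩, ⟨h₃, h₄⟩ | ⟨h₃, h₄⟩, h⟩
      · exact Or.inl ⟨⟨x, y, h₁, h₃, h⟩, h₂, h₄⟩
      · exact Or.inr (Or.inr ⟨⟨x, h₁⟩, h₂, h₃, y, h₄⟩)
      · exact absurd (hst y (mem_of h₃) x (mem_of h₂)) h.not_gt
      · exact Or.inr (Or.inl ⟨⟨x, y, h₂, h₄, h⟩, h₁, h₃⟩)
    · rintro (⟨⟨x, y, h₁, h₃, h⟩, h₂, h₄⟩ | ⟨⟨x, y, h₂, h₄, h⟩, h₁, h₃⟩ | ⟨⟨x, h₁⟩, h₂, h₃, y, h₄⟩)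
      · exact ⟨x, y, Or.inl ⟨h₁, h₂⟩, Or.inl ⟨h₃, h₄⟩, h⟩
      · exact ⟨x, y, Or.inr ⟨h₁, h₂⟩, Or.inr ⟨h₃, h₄⟩, h⟩
      · exact ⟨x, y, Or.inl ⟨h₁, h₂⟩, Or.inr ⟨h₃, h₄⟩, hst x (mem_of h₁) y (mem_of h₄)⟩
  rw [msoType_zero_eq_iff] at hs ht ⊢
  obtain ⟨se, ss, sm, sl⟩ := hs
  obtain ⟨te, ts, tm, tl⟩ := ht
  refine ⟨fun i => ?_, fun i => ?_, fun i j => ?_, fun i j => ?_⟩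
  · simp only [Set.inter_union_distrib_left, Set.union_empty_iff, se, te]
  · rw [hsing, hsing, ss, te, se, ts]
  · rw [hmem, hmem, sm, te, se, tm]
  · rw [hlt, hlt, sl, te, te, tl, se, se, ss, ts]

/-- Composition: the type on an ordered sum is determined by the types on the summands. -/
theorem msoType_union {s t : Set A} (hst : ∀ x ∈ s, ∀ y ∈ t, x < y) (d : ℕ) :
    ∀ {n : ℕ} {v w : Fin n → Set A}, msoType s d v = msoType s d w →
      msoType t d v = msoType t d w → msoType (s ∪ t) d v = msoType (s ∪ t) d w := by
  induction d with
  | zero => exact fun hs ht => msoType_zero_union hst hs ht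
  | succ d ih =>
    intro n v w hs ht
    have hd : Disjoint s t := Set.disjoint_left.2 fun x hx hy => lt_irrefl x (hst x hx x hy)
    -- Witnesses chosen separately on `s` and `t` merge into one set, since types see only traces.
    have glue : ∀ (v : Fin n → Set A) (S T : Set A),
        msoType s d (Matrix.vecCons (S ∩ s ∪ T ∩ t) v) = msoType s d (Matrix.vecCons S v) ∧
        msoType t d (Matrix.vecCons (S ∩ s ∪ T ∩ t) v) = msoType t d (Matrix.vecCons T v) := by
      intro v S T
      constructor
      · refine msoType_congr d (Fin.cases ?_ fun i => rfl)
        simp [Set.union_inter_distrib_right, Set.inter_assoc, hd.symm.inter_eq]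
      · refine msoType_congr d (Fin.cases ?_ fun i => rfl)
        simp [Set.union_inter_distrib_right, Set.inter_assoc, hd.inter_eq]
    rw [msoType_succ_eq_iff] at hs ht
    refine msoType_succ_eq_iff.2 ⟨ih hs.1 ht.1, fun S => ?_, fun T => ?_⟩
    · obtain ⟨T₁, h₁⟩ := hs.2.1 S
      obtain ⟨T₂, h₂⟩ := ht.2.1 S
      exact ⟨_, ih (h₁.trans (glue w T₁ T₂).1.symm) (h₂.trans (glue w T₁ T₂).2.symm)⟩
    · obtain ⟨S₁, h₁⟩ := hs.2.2 T
      obtain ⟨S₂, h₂⟩ := ht.2.2 T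
      exact ⟨_, ih ((glue v S₁ S₂).1.trans h₁) ((glue v S₁ S₂).2.trans h₂)⟩

/-- Satisfaction of a formula is determined by the type of some finite depth. -/
theorem MSOFormula.exists_realize_iff_of_msoType_eq {n : ℕ} (φ : MSOFormula n) :
    ∃ d, ∀ v w : Fin n → Set A, msoType Set.univ d v = msoType Set.univ d w →
      (φ.Realize v ↔ φ.Realize w) := by
  induction φ with
  | sing i =>
    refine ⟨0, fun v w h => ?_⟩
    simpa only [Set.inter_univ, MSOFormula.Realize] using (msoType_zero_eq_iff.1 h).2.1 i
  | mem i j =>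
    refine ⟨0, fun v w h => ?_⟩
    simpa only [Set.inter_univ, MSOFormula.Realize] using (msoType_zero_eq_iff.1 h).2.2.1 i j
  | lt i j =>
    refine ⟨0, fun v w h => ?_⟩
    simpa only [Set.inter_univ, MSOFormula.Realize] using (msoType_zero_eq_iff.1 h).2.2.2 i j
  | not φ ih =>
    obtain ⟨d, h⟩ := ih
    exact ⟨d, fun v w hvw => not_congr (h v w hvw)⟩
  | and φ ψ ih₁ ih₂ =>
    obtain ⟨d, h₁⟩ := ih₁
    obtain ⟨e, h₂⟩ := ih₂
    exact ⟨max d e, fun v w hvw => and_congr (h₁ v w (msoType_eq_of_le (le_max_left d e) hvw))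
      (h₂ v w (msoType_eq_of_le (le_max_right d e) hvw))⟩
  | ex φ ih =>
    obtain ⟨d, h⟩ := ih
    refine ⟨d + 1, fun v w hvw => ?_⟩
    obtain ⟨-, h₁, h₂⟩ := msoType_succ_eq_iff.1 hvw
    constructor
    · rintro ⟨S, hS⟩
      obtain ⟨T, hT⟩ := h₁ S
      exact ⟨T, (h _ _ hT).1 hS⟩
    · rintro ⟨T, hT⟩
      obtain ⟨S, hS⟩ := h₂ T
      exact ⟨S, (h _ _ hS).2 hT⟩

end Types

/-! ### Transfer of lower bounds to the defined well-ordering. -/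

section Invariance

open Ordinal

variable {A : Type u} [LinearOrder A]

/-- On `s`, the relation `R` is determined by types, with parameters, in the substructure `s`. -/
def TypeInvariant (s : Set A) (R : A → A → Prop) : Prop :=
  ∃ (l d : ℕ) (P : Fin l → Set A), ∀ x ∈ s, ∀ y ∈ s, ∀ x' ∈ s, ∀ y' ∈ s,
    msoType s d (Matrix.vecCons {x} (Matrix.vecCons {y} P)) =
      msoType s d (Matrix.vecCons {x'} (Matrix.vecCons {y'} P)) → (R x y ↔ R x' y')

theorem MSOFormula.typeInvariant_definedRel {l : ℕ} (φ : MSOFormula (l + 2)) (P : Fin l → Set A) :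
    TypeInvariant Set.univ (φ.definedRel P) := by
  obtain ⟨d, h⟩ := φ.exists_realize_iff_of_msoType_eq (A := A)
  exact ⟨l, d, P, fun x _ y _ x' _ y' _ hxy => h _ _ hxy⟩

theorem msoType_pair_of_disjoint {s t : Set A} (hd : Disjoint s t) (d : ℕ) {n : ℕ}
    (v : Fin n → Set A) {x y x' y' : A} (hx : x ∈ s) (hy : y ∈ s) (hx' : x' ∈ s) (hy' : y' ∈ s) :
    msoType t d (Matrix.vecCons {x} (Matrix.vecCons {y} v)) =
      msoType t d (Matrix.vecCons {x'} (Matrix.vecCons {y'} v)) := by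
  refine msoType_congr d (Fin.cases ?_ (Fin.cases ?_ fun i => rfl))
  · simp [Set.disjoint_left.1 hd hx, Set.disjoint_left.1 hd hx']
  · simp [Set.disjoint_left.1 hd hy, Set.disjoint_left.1 hd hy']

theorem disjoint_of_forall_lt {s t : Set A} (hst : ∀ x ∈ s, ∀ y ∈ t, x < y) : Disjoint s t :=
  Set.disjoint_left.2 fun x hx hy => lt_irrefl x (hst x hx x hy)

variable {R : A → A → Prop}

/-- Pairs from `s` have empty trace on `t`, so `t` cannot distinguish them and equal types on `s`
remain equal on the sum. -/
theorem TypeInvariant.left {s t : Set A} (hst : ∀ x ∈ s, ∀ y ∈ t, x < y)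
    (h : TypeInvariant (s ∪ t) R) : TypeInvariant s R := by
  obtain ⟨l, d, P, h⟩ := h
  refine ⟨l, d, P, fun x hx y hy x' hx' y' hy' e => ?_⟩
  exact h x (Or.inl hx) y (Or.inl hy) x' (Or.inl hx') y' (Or.inl hy') (msoType_union hst d e
    (msoType_pair_of_disjoint (disjoint_of_forall_lt hst) d P hx hy hx' hy'))

theorem TypeInvariant.right {s t : Set A} (hst : ∀ x ∈ s, ∀ y ∈ t, x < y)
    (h : TypeInvariant (s ∪ t) R) : TypeInvariant t R := by
  obtain ⟨l, d, P, h⟩ := h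
  refine ⟨l, d, P, fun x hx y hy x' hx' y' hy' e => ?_⟩
  exact h x (Or.inr hx) y (Or.inr hy) x' (Or.inr hx') y' (Or.inr hy') (msoType_union hst d
    (msoType_pair_of_disjoint (disjoint_of_forall_lt hst).symm d P hx hy hx' hy') e)

/-- The upper summand of an ordered sum has a finite colouring such that every element of the lower
summand compares in the same way with all elements of one colour. -/
theorem TypeInvariant.exists_colouring {s t : Set A} (hst : ∀ x ∈ s, ∀ y ∈ t, x < y)
    (h : TypeInvariant (s ∪ t) R) : ∃ (Q : Type) (_ : Finite Q) (c : A → Q),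
      ∀ x ∈ s, ∀ y ∈ t, ∀ y' ∈ t, c y = c y' → (R x y ↔ R x y') := by
  obtain ⟨l, d, P, h⟩ := h
  refine ⟨MSOType d (l + 2), inferInstance,
    -- `∅` stands for the trace on `t` of any `{x}` with `x ∈ s`, making the colouring independent
    -- of `x`.
    fun y => msoType t d (Matrix.vecCons ∅ (Matrix.vecCons {y} P)), ?_⟩
  intro x hx y hy y' hy' e
  have hd := disjoint_of_forall_lt hst
  refine h x (Or.inl hx) y (Or.inr hy) x (Or.inl hx) y' (Or.inr hy') (msoType_union hst d ?_ ?_)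
  · refine msoType_congr d (Fin.cases rfl (Fin.cases ?_ fun i => rfl))
    simp [Set.disjoint_right.1 hd hy, Set.disjoint_right.1 hd hy']
  · have hempty : ∀ z, msoType t d (Matrix.vecCons {x} (Matrix.vecCons {z} P)) =
        msoType t d (Matrix.vecCons ∅ (Matrix.vecCons {z} P)) := by
      intro z
      refine msoType_congr d (Fin.cases ?_ fun i => rfl)
      simp [Set.disjoint_left.1 hd hx]
    rw [hempty, hempty]
    exact e

variable [IsWellOrder A R]

/-- `one` must cover all invariant sets, because it is applied to the final segment `u`. -/
theorem TypeInvariant.omega0_opow_mul_le [WellFoundedLT A] (a : Ordinal.{u})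
    (one : ∀ s : Set A, TypeInvariant s R → ω ^ a ≤ subsetType (A := A) (· < ·) s → ω ^ a ≤ subsetType R s)
    (n : ℕ) : ∀ s : Set A, TypeInvariant s R → ω ^ a * n ≤ subsetType (A := A) (· < ·) s →
      ω ^ a * n ≤ subsetType R s := by
  induction n with
  | zero => simp
  | succ n ih =>
    intro s hs h
    rw [Nat.cast_succ, mul_add, mul_one] at h
    obtain ⟨t, u, rfl, htu, ht, hu⟩ := exists_split_of_add_le_subsetType (A := A) (· < ·) h
    obtain ⟨Q, _, c, hc⟩ := hs.exists_colouring htu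
    obtain ⟨q, hq⟩ := exists_colour_omega0_opow_le R c (one u (hs.right htu) hu)
    refine (omega0_opow_mul_succ_le_subsetType_union R
      ((disjoint_of_forall_lt htu).mono_right fun x hx => hx.1) ?_
      (ih t (hs.left htu) ht) hq).trans
      (subsetType_mono R (Set.union_subset_union_right t fun x hx => hx.1))
    exact fun x hx y hy y' hy' => hc x hx y hy.1 y' hy'.1 (hy.2.trans hy'.2.symm)

theorem TypeInvariant.omega0_opow_le [WellFoundedLT A] (a : Ordinal.{u}) :
    ∀ s : Set A, TypeInvariant s R → ω ^ a ≤ subsetType (A := A) (· < ·) s → ω ^ a ≤ subsetType R s := by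
  induction a using Ordinal.limitRecOn with
  | zero =>
    intro s _ h
    simp only [opow_zero, Order.one_le_iff_ne_zero, ne_eq, subsetType_eq_zero_iff] at h ⊢
    exact h
  | add_one a ih =>
    intro s hs h
    simp only [opow_succ_le_iff_forall_nat] at h ⊢
    exact fun n => TypeInvariant.omega0_opow_mul_le a ih n s hs (h n)
  | limit a ha ih =>
    intro s hs h
    simp only [opow_le_of_isSuccLimit omega0_ne_zero ha] at h ⊢
    exact fun b hb => ih b hb s hs (h b hb)

end Invariance

/-! ### Consequences for `α → β`. -/

theorem MSOArrow.omega0_opow_mul_le {α β : Ordinal.{u}} (h : MSOArrow α β) {a : Ordinal.{u}} {n : ℕ}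
    (hα : Ordinal.omega0 ^ a * n ≤ α) : Ordinal.omega0 ^ a * n ≤ β := by
  obtain ⟨l, φ, P, _, rfl⟩ := h
  rw [← subsetType_univ]
  refine TypeInvariant.omega0_opow_mul_le a (TypeInvariant.omega0_opow_le a) n _
    (φ.typeInvariant_definedRel P) ?_
  rwa [subsetType_univ, Ordinal.type_toType]

open Ordinal in
theorem MSOArrow.exists_rotation {α β : Ordinal.{u}} (h : MSOArrow α β) (hβ : β < α) :
    ∃ γ₁ γ₂ : Ordinal.{u}, γ₁ + γ₂ = α ∧ γ₂ + γ₁ = β := by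
  have hα : α ≠ 0 := (pos_of_gt hβ).ne'
  -- `n` is the leading coefficient in the Cantor normal form of `α`.
  obtain ⟨n, hn⟩ := lt_omega0.1 (div_opow_log_lt α one_lt_omega0)
  have hne : (ω ^ log ω α) ≠ 0 := (opow_pos _ omega0_pos).ne'
  have hα' : ω ^ log ω α * n ≤ α := by rw [← hn]; exact mul_div_le _ _
  have hle : ω ^ log ω α * n ≤ β := h.omega0_opow_mul_le hα'
  have hlog : ω ^ log ω α ≤ β := by
    simpa using h.omega0_opow_mul_le (n := 1) (by simpa using opow_log_le_self ω hα)
  refine ⟨β, α - β, Ordinal.add_sub_cancel_of_le hβ.le, add_of_omega0_opow_le ?_ hlog⟩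
  refine lt_of_le_of_lt (Ordinal.sub_le.2 ?_) (mod_lt α hne)
  calc α = ω ^ log ω α * n + α % ω ^ log ω α := by rw [← hn, div_add_mod]
    _ ≤ β + α % ω ^ log ω α := by gcongr

open Ordinal in
theorem not_msoArrow_omega0_add_omega0 : ¬ MSOArrow (ω + ω : Ordinal.{u}) ω := by
  intro h
  have key : (ω : Ordinal.{u}) ^ (1 : Ordinal.{u}) * (2 : ℕ) ≤ ω :=
    h.omega0_opow_mul_le (by rw [opow_one, Nat.cast_ofNat, ← one_add_one_eq_two, mul_add, mul_one])
  rw [opow_one, Nat.cast_ofNat, ← one_add_one_eq_two, mul_add, mul_one] at key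
  exact key.not_gt (lt_add_of_pos_right ω omega0_pos)

theorem claim4p6 :
    (∀ α β : Ordinal.{u}, MSOArrow α β → β < α →
      ∃ γ₁ γ₂ : Ordinal.{u}, γ₁ + γ₂ = α ∧ γ₂ + γ₁ = β) ∧
    ¬ MSOArrow (Ordinal.omega0.{u} + Ordinal.omega0.{u}) Ordinal.omega0.{u} :=
  ⟨fun _ _ h hβ => h.exists_rotation hβ, not_msoArrow_omega0_add_omega0⟩
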